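/- Let $\Lambda=[-\pi,\pi]$. For $f\in L^1(\Lambda)$, $f\ge 0$, and $n\ge 0$ let $$\sigma_n^2(f)=\min_{c_1,\dots,c_n\in\mathbb{C}}\int_{-\pi}^{\pi}\Big|1-\sum_{k=1}^n c_k e^{-ik\lambda}\Big|^2 f(\lambda)\,d\lambda ,\qquad \sigma_n(f)=\sqrt{\sigma_n^2(f)},$$ the error of the best linear one-step prediction, from the past of length $n$, of a stationary process with spectral density $f$. For $f\ge0$ let $G(f)=\exp\big(\frac1{2\pi}\int_{-\pi}^{\pi}\ln f(\lambda)\,d\lambda\big)$ if $\ln f\in L^1(\Lambda)$ (where $\ln 0=-\infty$), and $G(f)=0$ otherwise. Let $$\mathcal F=\Big\{f\in L^1(\Lambda):\ f\ge 0,\ G(f)=0,\ \lim_{n\to\infty}\frac{\sigma_{n+1}(f)}{\sigma_n(f)}=1\Big\},$$ and for $f\in\mathcal F$ let $$\mathcal M_f=\Big\{g\ge 0:\ G(g)>0,\ fg\in L^1(\Lambda),\ \lim_{n\to\infty}\frac{\sigma_n^2(fg)}{\sigma_n^2(f)}=G(g)\Big\}.$$ Let $B_+^-$ be the set of all Riemann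 integrable functions $h$ on $\Lambda$ with $m\le h\le M$ for some constants $m,M>0$. A trigonometric polynomial is a function $a_0+\sum_{k=1}^{\nu}(a_k\cos k\lambda+b_k\sin k\lambda)$ with real coefficients. Theorem. Let $f\in\mathcal F$ and $h\in B_+^-$. (i) If $g=h\cdot|t|^{\alpha}$, where $t$ is a trigonometric polynomial that is not identically zero and $\alpha>0$ is real, then $g\in\mathcal M_f$ and $fg\in\mathcal F$. (ii) If $g=h\cdot t_1/t_2$, where $t_1,t_2$ are nonnegative trigonometric polynomials that are not identically zero, and if $fg\in L^1(\Lambda)$, then $g\in\mathcal M_f$ and $fg\in\mathcal F$. -/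

import Mathlib

open MeasureTheory Filter Topology

noncomputable section

namespace FinitePrediction

/-- The interval `Λ = [-π, π]`. -/
def Lam : Set ℝ := Set.Icc (-Real.pi) Real.pi

/-- The finite prediction error `σ_n²(f)`: the minimal mean squared error
`E|X(0) - ∑_{k=1}^n c_k X(-k)|²` of a linear one-step predictor of a stationary process with
spectral density `f` based on the past of length `n`. Under the isometry `X(k) ↔ e^{ikλ}` of the
time domain with `L²(f dλ)` it is the minimum of `‖1 - ∑_{k=1}^n c_k e^{-ikλ}‖²` in `L²(f dλ)`. The
coefficients are complex, since the densities considered need not be even. The index `k : Fin n`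
stands for the integer `k + 1`. -/
def predErrSq (f : ℝ → ℝ) (n : ℕ) : ℝ :=
  ⨅ c : Fin n → ℂ, ∫ x in Lam,
    ‖1 - ∑ k : Fin n, c k * Complex.exp (-(Complex.I * ((k : ℕ) + 1 : ℂ) * (x : ℂ)))‖ ^ 2 * f x

/-- The square root `σ_n(f)` of the prediction error. -/
def predErr (f : ℝ → ℝ) (n : ℕ) : ℝ := Real.sqrt (predErrSq f n)

open Classical in
/-- The geometric mean `G(f) = exp((1/2π) ∫_Λ ln f)` of a nonnegative function `f` if `ln f ∈ L¹(Λ)`,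
and `0` otherwise. As `ln 0 = -∞` in this definition (whereas `Real.log 0 = 0`), `ln f ∈ L¹(Λ)`
includes that `f > 0` almost everywhere on `Λ`. -/
def geomMean (f : ℝ → ℝ) : ℝ :=
  if (∀ᵐ x ∂(volume.restrict Lam), 0 < f x) ∧ IntegrableOn (fun x => Real.log (f x)) Lam then
    Real.exp ((1 / (2 * Real.pi)) * ∫ x in Lam, Real.log (f x))
  else 0

/-- The class `𝓕`: nonnegative `f ∈ L¹(Λ)` (so nonnegative almost everywhere) with `G(f) = 0`, that is,
spectral densities of deterministic processes, for which `σ_n(f)` is weakly varying. -/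
def classF : Set (ℝ → ℝ) :=
  {f | IntegrableOn f Lam ∧ (∀ᵐ x ∂(volume.restrict Lam), 0 ≤ f x) ∧ geomMean f = 0 ∧
    Tendsto (fun n : ℕ => predErr f (n + 1) / predErr f n) atTop (𝓝 1)}

/-- The class `𝓜_f` attached to a function `f` of the class `𝓕`. -/
def classM (f : ℝ → ℝ) : Set (ℝ → ℝ) :=
  {g | (∀ x ∈ Lam, 0 ≤ g x) ∧ 0 < geomMean g ∧ IntegrableOn (fun x => f x * g x) Lam ∧
    Tendsto (fun n : ℕ => predErrSq (fun x => f x * g x) n / predErrSq f n) atTop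
      (𝓝 (geomMean g))}

/-- A finite partition `a = x_0 ≤ x_1 ≤ ⋯ ≤ x_n = b` of the interval `[a, b]`. -/
structure IntervalPartition (a b : ℝ) where
  /-- The number of subintervals. -/
  n : ℕ
  /-- The division points; only those of index at most `n` matter. -/
  pt : ℕ → ℝ
  mono : Monotone pt
  first : pt 0 = a
  last : pt n = b

/-- The upper Darboux sum. -/
def upperSum (h : ℝ → ℝ) {a b : ℝ} (P : IntervalPartition a b) : ℝ :=
  ∑ i ∈ Finset.range P.n, sSup (h '' Set.Icc (P.pt i) (P.pt (i + 1))) * (P.pt (i + 1) - P.pt i)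

/-- The lower Darboux sum. -/
def lowerSum (h : ℝ → ℝ) {a b : ℝ} (P : IntervalPartition a b) : ℝ :=
  ∑ i ∈ Finset.range P.n, sInf (h '' Set.Icc (P.pt i) (P.pt (i + 1))) * (P.pt (i + 1) - P.pt i)

/-- Riemann integrability on `[a, b]`: the function is bounded on `[a, b]`, and its upper and lower
Darboux integrals coincide. -/
def IsRiemannIntegrable (h : ℝ → ℝ) (a b : ℝ) : Prop :=
  BddAbove (h '' Set.Icc a b) ∧ BddBelow (h '' Set.Icc a b) ∧
    (⨅ P : IntervalPartition a b, upperSum h P) = ⨆ P : IntervalPartition a b, lowerSum h P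

/-- The class `B₊⁻` of functions that are Riemann integrable on `Λ` and lie between two positive
constants there. -/
def classBpm : Set (ℝ → ℝ) :=
  {h | IsRiemannIntegrable h (-Real.pi) Real.pi ∧
    ∃ m M : ℝ, 0 < m ∧ 0 < M ∧ ∀ x ∈ Lam, m ≤ h x ∧ h x ≤ M}

/-- (Real) trigonometric polynomials `a_0 + ∑_{k=1}^ν (a_k cos kλ + b_k sin kλ)`. -/
def IsTrigPoly (t : ℝ → ℝ) : Prop :=
  ∃ (ν : ℕ) (a b : ℕ → ℝ), ∀ x : ℝ,
    t x = a 0 + ∑ k ∈ Finset.Icc 1 ν, (a k * Real.cos (k * x) + b k * Real.sin (k * x))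

end FinitePrediction

end

/-! After conjugation, the admissible trigonometric sums become the polynomials `q` of degree at
most `n` with `q(0) = 1`, and `σ_n²(f)` is the infimum of `∫ |q|² f` over the unit circle. Suppose
`|Q|² ≤ g` there for a polynomial `Q`. Reflecting its zeros gives `s` with `|s| = |Q|` on the circle
and `|s(0)|` the Mahler measure `M(Q)`. Multiplying competitors for `fg` by `s` yields `M(Q)²
σ²_{n+ν}(f) ≤ σ_n²(fg)` with `ν = deg s`. If instead `|Q|² ≤ 1/g`, the same argument exchanges `f`
and `fg`. Since `σ_n(f)` is weakly varying, the shift by `ν` is harmless in the limit. So it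
suffices that both `g` and `1/g` be minorized by such `|Q|²` with `M(Q)²`, the geometric mean of
`|Q|²`, arbitrarily close to theirs (`PolyMinorized`, `mem_classM_of_polyMinorized`). Only minorants
are needed, so zeros and poles of `g` do no harm.

For a weight between positive constants that is continuous almost everywhere, its logarithm is
approximated from below by continuous functions, and then trigonometric polynomials are used
(`polyMinorized_of_ae_continuousAt`). Factors `|P|²/c` with `c ≥ 0` continuous are handled by
replacing `c` with `c + δ` and letting `δ → 0` (`polyMinorized_mul_div`). Both kinds of `g`, and
their reciprocals, have this form. -/

noncomputable section

namespace FinitePrediction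

open Polynomial

/-! ### Prediction errors as a polynomial extremal problem -/

/-- The squared norm of `q(e^{iλ})` in `L²(f dλ)`. -/
def energy (f : ℝ → ℝ) (q : ℂ[X]) : ℝ :=
  ∫ x in Lam, ‖q.eval (circleMap 0 1 x)‖ ^ 2 * f x

/-- The polynomial `1 - ∑ conj(c_k) X^{k+1}`, whose values on the unit circle are the conjugates of
`1 - ∑ c_k e^{-i(k+1)λ}`. -/
def predPoly {n : ℕ} (c : Fin n → ℂ) : ℂ[X] :=
  1 - ∑ k : Fin n, C (starRingEnd ℂ (c k)) * X ^ ((k : ℕ) + 1)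

lemma natDegree_predPoly_le {n : ℕ} (c : Fin n → ℂ) : (predPoly c).natDegree ≤ n := by
  refine (natDegree_sub_le _ _).trans (max_le (by simp) ?_)
  refine natDegree_sum_le_of_forall_le _ _ fun k _ => ?_
  exact (natDegree_C_mul_X_pow_le _ _).trans k.2

lemma eval_zero_predPoly {n : ℕ} (c : Fin n → ℂ) : (predPoly c).eval 0 = 1 := by
  simp [predPoly, eval_finsetSum]

lemma norm_eval_predPoly {n : ℕ} (c : Fin n → ℂ) (x : ℝ) :
    ‖(predPoly c).eval (circleMap 0 1 x)‖ =
      ‖1 - ∑ k : Fin n, c k * Complex.exp (-(Complex.I * ((k : ℕ) + 1 : ℂ) * (x : ℂ)))‖ := by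
  rw [← RCLike.norm_conj (1 - ∑ k : Fin n, _)]
  congr 1
  simp only [predPoly, eval_sub, eval_one, eval_finsetSum, eval_mul, eval_C, eval_pow, eval_X,
    map_sub, map_one, map_sum, map_mul, ← Complex.exp_conj]
  congr 1
  refine Finset.sum_congr rfl fun k _ => ?_
  congr 1
  simp only [circleMap, Complex.ofReal_one, one_mul, zero_add, ← Complex.exp_nat_mul]
  congr 1
  simp
  ring

lemma predErrSq_eq (f : ℝ → ℝ) (n : ℕ) :
    predErrSq f n = ⨅ c : Fin n → ℂ, energy f (predPoly c) := by
  simp only [predErrSq, energy, norm_eval_predPoly]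

lemma predPoly_neg_conj_coeff {n : ℕ} {q : ℂ[X]} (hq : q.natDegree ≤ n) (h0 : q.eval 0 = 1) :
    predPoly (fun k : Fin n => -starRingEnd ℂ (q.coeff ((k : ℕ) + 1))) = q := by
  have h1 : q.coeff 0 = 1 := by rw [coeff_zero_eq_eval_zero, h0]
  conv_rhs => rw [as_sum_range_C_mul_X_pow' q (Nat.lt_succ_of_le hq), Finset.sum_range_succ']
  simp [predPoly, h1, Finset.sum_range, add_comm]

lemma energy_nonneg {f : ℝ → ℝ} (hf : ∀ᵐ x ∂(volume.restrict Lam), 0 ≤ f x) (q : ℂ[X]) :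
    0 ≤ energy f q := by
  refine integral_nonneg_of_ae ?_
  filter_upwards [hf] with x hx
  simp only [Pi.zero_apply]
  positivity

lemma predErrSq_nonneg {f : ℝ → ℝ} (hf : ∀ᵐ x ∂(volume.restrict Lam), 0 ≤ f x) (n : ℕ) :
    0 ≤ predErrSq f n := by
  rw [predErrSq_eq]
  exact Real.iInf_nonneg fun c => energy_nonneg hf _

lemma energy_C_mul (f : ℝ → ℝ) (a : ℂ) (q : ℂ[X]) :
    energy f (C a * q) = ‖a‖ ^ 2 * energy f q := by
  simp only [energy, eval_mul, eval_C, norm_mul, mul_pow, mul_assoc]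
  exact integral_const_mul _ _

/-- Homogeneity removes the normalization `q(0) = 1`; products with a reflected polynomial can then
be used as competitors directly. -/
lemma norm_sq_mul_predErrSq_le {f : ℝ → ℝ} (hf : ∀ᵐ x ∂(volume.restrict Lam), 0 ≤ f x) {n : ℕ}
    {q : ℂ[X]} (hq : q.natDegree ≤ n) : ‖q.eval 0‖ ^ 2 * predErrSq f n ≤ energy f q := by
  by_cases h0 : q.eval 0 = 0
  · simpa [h0] using energy_nonneg hf q
  have h1 : q = C (q.eval 0) * (C (q.eval 0)⁻¹ * q) := by
    rw [← mul_assoc, ← C_mul, mul_inv_cancel₀ h0]; simp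
  have h2 : (C (q.eval 0)⁻¹ * q).natDegree ≤ n := (natDegree_C_mul_le _ _).trans hq
  have h3 : (C (q.eval 0)⁻¹ * q).eval 0 = 1 := by simp [inv_mul_cancel₀ h0]
  conv_rhs => rw [h1, energy_C_mul]
  gcongr
  rw [predErrSq_eq, ← predPoly_neg_conj_coeff h2 h3]
  exact ciInf_le ⟨0, by rintro _ ⟨c, rfl⟩; exact energy_nonneg hf _⟩ _

lemma le_predErrSq {f : ℝ → ℝ} {n : ℕ} {a : ℝ}
    (h : ∀ q : ℂ[X], q.natDegree ≤ n → q.eval 0 = 1 → a ≤ energy f q) : a ≤ predErrSq f n := by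
  rw [predErrSq_eq]
  exact le_ciInf fun c => h _ (natDegree_predPoly_le c) (eval_zero_predPoly c)

lemma continuous_eval_circleMap (q : ℂ[X]) : Continuous fun x : ℝ => q.eval (circleMap 0 1 x) :=
  q.continuous.comp (continuous_circleMap 0 1)

lemma integrableOn_energy {f : ℝ → ℝ} (hf : IntegrableOn f Lam) (q : ℂ[X]) :
    IntegrableOn (fun x => ‖q.eval (circleMap 0 1 x)‖ ^ 2 * f x) Lam :=
  hf.continuousOn_mul ((continuous_eval_circleMap q).norm.pow 2).continuousOn isCompact_Icc

/-! ### Reflection of zeros and comparison of prediction errors -/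

lemma norm_one_sub_conj_mul {a z : ℂ} (hz : ‖z‖ = 1) :
    ‖1 - starRingEnd ℂ a * z‖ = ‖z - a‖ := by
  have : 1 - starRingEnd ℂ a * z = z * starRingEnd ℂ (z - a) := by
    have : z * starRingEnd ℂ z = 1 := by rw [Complex.mul_conj, Complex.normSq_eq_norm_sq, hz]; simp
    rw [map_sub, mul_sub, this]; ring
  rw [this, norm_mul, hz, RCLike.norm_conj, one_mul]

/-- A polynomial has the same modulus on the unit circle as one whose value at `0` is the Mahler
measure, obtained by reflecting the zeros in the unit disc. -/
lemma exists_outer (Q : ℂ[X]) : ∃ s : ℂ[X],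
    (∀ x : ℝ, ‖s.eval (circleMap 0 1 x)‖ = ‖Q.eval (circleMap 0 1 x)‖) ∧
      ‖s.eval 0‖ = Q.mahlerMeasure := by
  have key : ∀ S : Multiset ℂ, ∃ s : ℂ[X],
      (∀ x : ℝ, ‖s.eval (circleMap 0 1 x)‖ =
        ‖((S.map fun a => X - C a).prod).eval (circleMap 0 1 x)‖) ∧
      ‖s.eval 0‖ = (S.map fun a => max 1 ‖a‖).prod := by
    intro S
    induction S using Multiset.induction with
    | empty => exact ⟨1, by simp, by simp⟩
    | cons a S ih =>
      obtain ⟨s, h1, h2⟩ := ih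
      rcases le_total ‖a‖ 1 with ha | ha
      -- A zero in the closed disc is reflected, so its factor takes the value `1` at `0`; a zero
      -- outside is kept and contributes `‖a‖`. In both cases this is `max 1 ‖a‖`.
      · refine ⟨(1 - C (starRingEnd ℂ a) * X) * s, fun x => ?_, ?_⟩
        · rw [Multiset.map_cons, Multiset.prod_cons, eval_mul, eval_mul, norm_mul, norm_mul, h1]
          congr 1
          simp only [eval_sub, eval_one, eval_mul, eval_C, eval_X]
          exact norm_one_sub_conj_mul (by simp)
        · simp [h2, max_eq_left ha]
      · refine ⟨(X - C a) * s, fun x => ?_, ?_⟩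
        · rw [Multiset.map_cons, Multiset.prod_cons, eval_mul, eval_mul, norm_mul, norm_mul, h1]
        · simp [h2, max_eq_right ha]
  obtain ⟨s, h1, h2⟩ := key Q.roots
  refine ⟨C Q.leadingCoeff * s, fun x => ?_, ?_⟩
  · conv_rhs => rw [(IsAlgClosed.splits Q).eq_prod_roots]
    simp only [eval_mul, norm_mul, h1]
  · rw [mahlerMeasure_eq_leadingCoeff_mul_prod_roots, eval_mul, norm_mul, h2, eval_C]

section Comparison

variable {f g : ℝ → ℝ}

/-- If `q` competes for `fg` in degree `n`, then `q * s`, with `s` from `exists_outer`, competes for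
`f` in degree `n + deg s`, and `|s|² f ≤ fg`. -/
lemma exists_mahlerMeasure_mul_predErrSq_le (hf : ∀ᵐ x ∂(volume.restrict Lam), 0 ≤ f x)
    (hf' : IntegrableOn f Lam) (hfg : IntegrableOn (fun x => f x * g x) Lam) {Q : ℂ[X]}
    (hQ : ∀ᵐ x ∂(volume.restrict Lam), ‖Q.eval (circleMap 0 1 x)‖ ^ 2 ≤ g x) :
    ∃ ν : ℕ, ∀ n, Q.mahlerMeasure ^ 2 * predErrSq f (n + ν) ≤
      predErrSq (fun x => f x * g x) n := by
  obtain ⟨s, hs, hs0⟩ := exists_outer Q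
  refine ⟨s.natDegree, fun n => le_predErrSq fun q hq hq0 => ?_⟩
  have h1 : (q * s).natDegree ≤ n + s.natDegree := natDegree_mul_le.trans (by omega)
  have h2 := norm_sq_mul_predErrSq_le hf h1
  rw [eval_mul, hq0, one_mul, hs0] at h2
  refine h2.trans (integral_mono_ae (integrableOn_energy hf' _) (integrableOn_energy hfg _) ?_)
  filter_upwards [hQ, hf] with x hx hfx
  simp only [eval_mul, norm_mul, hs, mul_pow, mul_assoc]
  rw [mul_comm (f x)]
  gcongr

lemma exists_mahlerMeasure_mul_predErrSq_mul_le (hf : ∀ᵐ x ∂(volume.restrict Lam), 0 ≤ f x)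
    (hg : ∀ᵐ x ∂(volume.restrict Lam), 0 ≤ g x)
    (hf' : IntegrableOn f Lam) (hfg : IntegrableOn (fun x => f x * g x) Lam) {Q : ℂ[X]}
    (hQ : ∀ᵐ x ∂(volume.restrict Lam), ‖Q.eval (circleMap 0 1 x)‖ ^ 2 * g x ≤ 1) :
    ∃ ν : ℕ, ∀ n, Q.mahlerMeasure ^ 2 * predErrSq (fun x => f x * g x) (n + ν) ≤
      predErrSq f n := by
  obtain ⟨s, hs, hs0⟩ := exists_outer Q
  refine ⟨s.natDegree, fun n => le_predErrSq fun q hq hq0 => ?_⟩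
  have h1 : (q * s).natDegree ≤ n + s.natDegree := natDegree_mul_le.trans (by omega)
  have hfg0 : ∀ᵐ x ∂(volume.restrict Lam), 0 ≤ f x * g x := by
    filter_upwards [hf, hg] with x h1 h2 using mul_nonneg h1 h2
  have h2 := norm_sq_mul_predErrSq_le hfg0 h1
  rw [eval_mul, hq0, one_mul, hs0] at h2
  refine h2.trans (integral_mono_ae (integrableOn_energy hfg _) (integrableOn_energy hf' _) ?_)
  filter_upwards [hQ, hf] with x hx hfx
  simp only [eval_mul, norm_mul, hs, mul_pow]
  calc _ = ‖q.eval (circleMap 0 1 x)‖ ^ 2 * (f x * (‖Q.eval (circleMap 0 1 x)‖ ^ 2 * g x)) := by ring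
    _ ≤ ‖q.eval (circleMap 0 1 x)‖ ^ 2 * (f x * 1) := by gcongr
    _ = _ := by ring

end Comparison

/-! ### Limits of ratios of errors and the abstract multiplier criterion -/

lemma tendsto_shift_div {a : ℕ → ℝ} (ha : ∀ᶠ n in atTop, 0 < a n)
    (h : Tendsto (fun n => a (n + 1) / a n) atTop (𝓝 1)) (ν : ℕ) :
    Tendsto (fun n => a (n + ν) / a n) atTop (𝓝 1) := by
  induction ν with
  | zero =>
    refine tendsto_const_nhds.congr' ?_
    filter_upwards [ha] with n hn
    simp [hn.ne']
  | succ k ih =>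
    have h1 := ((tendsto_add_atTop_iff_nat k).2 h).mul ih
    rw [one_mul] at h1
    refine h1.congr' ?_
    filter_upwards [(tendsto_add_atTop_nat k).eventually ha] with n hn
    rw [show n + (k + 1) = n + k + 1 by ring, div_mul_div_cancel₀ hn.ne']

/-- Two sequences that dominate each other up to shifts of the index, the first of which is weakly
varying, have a ratio that converges. -/
lemma tendsto_div_of_shift_le {a b : ℕ → ℝ} {G : ℝ} (hG : 0 < G) (ha : ∀ᶠ n in atTop, 0 < a n)
    (h : Tendsto (fun n => a (n + 1) / a n) atTop (𝓝 1))
    (hlow : ∀ κ, κ < G → ∃ ν : ℕ, ∀ n, κ * a (n + ν) ≤ b n)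
    (hup : ∀ κ, κ < G⁻¹ → ∃ ν : ℕ, ∀ n, κ * b (n + ν) ≤ a n) :
    Tendsto (fun n => b n / a n) atTop (𝓝 G) := by
  refine tendsto_order.2 ⟨fun c hc => ?_, fun c hc => ?_⟩
  · obtain ⟨κ, h1, h2⟩ := exists_between hc
    obtain ⟨ν, hν⟩ := hlow κ h2
    have h3 := (tendsto_shift_div ha h ν).const_mul κ
    rw [mul_one] at h3
    filter_upwards [h3.eventually (lt_mem_nhds h1), ha] with n h4 h5
    refine h4.trans_le ?_
    rw [← mul_div_assoc]
    gcongr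
    exact hν n
  · have hc0 : 0 < c := hG.trans hc
    obtain ⟨κ, h1, h2⟩ := exists_between (inv_strictAnti₀ hG hc)
    have hκ : 0 < κ := (inv_pos.2 hc0).trans h1
    obtain ⟨ν, hν⟩ := hup κ h2
    have h3 := ((tendsto_shift_div ha h ν).inv₀ one_ne_zero).const_mul κ⁻¹
    rw [inv_one, mul_one] at h3
    have h4 : κ⁻¹ < c := inv_lt_of_inv_lt₀ hc0 h1
    -- The upper bound controls `b` only at shifted indices, so the ratio is examined along `n + ν`.
    rw [← map_add_atTop_eq_nat ν, eventually_map]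
    filter_upwards [h3.eventually (gt_mem_nhds h4), (tendsto_add_atTop_nat ν).eventually ha]
      with n h5 h6
    refine lt_of_le_of_lt ?_ h5
    rw [inv_div, ← mul_div_assoc]
    gcongr
    rw [inv_mul_eq_div, le_div_iff₀ hκ, mul_comm]
    exact hν n

/-- `g` is bounded below by squared moduli of polynomials whose geometric means come arbitrarily
close to that of `g`. -/
def PolyMinorized (g : ℝ → ℝ) : Prop :=
  ∀ ε > 0, ∃ Q : ℂ[X], Q ≠ 0 ∧
    (∀ᵐ x ∂(volume.restrict Lam), ‖Q.eval (circleMap 0 1 x)‖ ^ 2 ≤ g x) ∧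
    (1 / (2 * Real.pi)) * (∫ x in Lam, Real.log (g x)) - ε ≤ 2 * Q.logMahlerMeasure

lemma PolyMinorized.exists_lt_mahlerMeasure {g : ℝ → ℝ} (h : PolyMinorized g) {κ : ℝ}
    (hκ : κ < Real.exp ((1 / (2 * Real.pi)) * ∫ x in Lam, Real.log (g x))) :
    ∃ Q : ℂ[X], (∀ᵐ x ∂(volume.restrict Lam), ‖Q.eval (circleMap 0 1 x)‖ ^ 2 ≤ g x) ∧
      κ ≤ Q.mahlerMeasure ^ 2 := by
  rcases le_or_gt κ 0 with h0 | h0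
  · obtain ⟨Q, -, h1, -⟩ := h 1 one_pos
    exact ⟨Q, h1, h0.trans (sq_nonneg _)⟩
  -- The tolerance is the gap between the logarithmic mean of `g` and `log κ`.
  obtain ⟨Q, hQ, h1, h2⟩ := h _ (sub_pos.2 ((Real.log_lt_iff_lt_exp h0).2 hκ))
  refine ⟨Q, h1, ?_⟩
  rw [sub_sub_cancel] at h2
  rw [mahlerMeasure, if_pos hQ, ← Real.exp_nat_mul, ← Real.log_le_iff_le_exp h0]
  exact_mod_cast h2

lemma predErr_sq {f : ℝ → ℝ} (hf : ∀ᵐ x ∂(volume.restrict Lam), 0 ≤ f x) (n : ℕ) :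
    predErr f n ^ 2 = predErrSq f n := Real.sq_sqrt (predErrSq_nonneg hf n)

/-- Division by zero gives `0`, so a ratio tending to `1` forces nonzero denominators from some
index on. -/
lemma eventually_predErrSq_pos {f : ℝ → ℝ} (hf : f ∈ classF) :
    ∀ᶠ n in atTop, 0 < predErrSq f n := by
  obtain ⟨-, h0, -, h⟩ := hf
  filter_upwards [h.eventually_ne one_ne_zero] with n hn
  refine (predErrSq_nonneg h0 n).lt_of_ne' fun h1 => hn ?_
  simp [predErr, h1]

lemma tendsto_predErrSq_succ_div {f : ℝ → ℝ} (hf : f ∈ classF) :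
    Tendsto (fun n => predErrSq f (n + 1) / predErrSq f n) atTop (𝓝 1) := by
  obtain ⟨-, h0, -, h⟩ := hf
  simpa [div_pow, predErr_sq h0] using h.pow 2

/-- Otherwise `log f = log (fg) - log g` would be integrable, making the geometric mean of `f`
positive. -/
lemma geomMean_mul_eq_zero {f g : ℝ → ℝ} (hf0 : geomMean f = 0) (hg : ∀ᵐ x ∂(volume.restrict Lam), 0 < g x)
    (hlog : IntegrableOn (fun x => Real.log (g x)) Lam) :
    geomMean (fun x => f x * g x) = 0 := by
  by_contra hne
  have h1 : (∀ᵐ x ∂(volume.restrict Lam), 0 < f x * g x) ∧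
      IntegrableOn (fun x => Real.log (f x * g x)) Lam := by
    by_contra h1
    exact hne (if_neg h1)
  obtain ⟨hpos, hint⟩ := h1
  have hfpos : ∀ᵐ x ∂(volume.restrict Lam), 0 < f x := by
    filter_upwards [hpos, hg] with x h1 h2 using pos_of_mul_pos_left h1 h2.le
  have hfint : IntegrableOn (fun x => Real.log (f x)) Lam := by
    refine (hint.sub hlog).congr ?_
    filter_upwards [hfpos, hg] with x h1 h2
    simp [Real.log_mul h1.ne' h2.ne']
  rw [geomMean, if_pos ⟨hfpos, hfint⟩] at hf0
  exact (Real.exp_pos _).ne' hf0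

/-- If `g` and `1 / g` are approximated from below by squared moduli of polynomials, then
multiplication by `g` preserves the class `𝓕`, and `g` belongs to `𝓜_f`. -/
theorem mem_classM_of_polyMinorized {f g : ℝ → ℝ} (hf : f ∈ classF) (hg0 : ∀ x ∈ Lam, 0 ≤ g x)
    (hg : ∀ᵐ x ∂(volume.restrict Lam), 0 < g x)
    (hlog : IntegrableOn (fun x => Real.log (g x)) Lam)
    (hfg : IntegrableOn (fun x => f x * g x) Lam)
    (hlow : PolyMinorized g) (hup : PolyMinorized fun x => (g x)⁻¹) :
    g ∈ classM f ∧ (fun x => f x * g x) ∈ classF := by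
  have hpos := eventually_predErrSq_pos hf
  have hsucc := tendsto_predErrSq_succ_div hf
  obtain ⟨hfi, hf0, hfG, hfv⟩ := hf
  have hG : geomMean g = Real.exp ((1 / (2 * Real.pi)) * ∫ x in Lam, Real.log (g x)) :=
    if_pos ⟨hg, hlog⟩
  have hGpos : 0 < geomMean g := hG ▸ Real.exp_pos _
  have hlim : Tendsto (fun n : ℕ => predErrSq (fun x => f x * g x) n / predErrSq f n) atTop
      (𝓝 (geomMean g)) := by
    refine tendsto_div_of_shift_le hGpos hpos hsucc (fun κ hκ => ?_) fun κ hκ => ?_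
    · obtain ⟨Q, h1, h2⟩ := hlow.exists_lt_mahlerMeasure (hG ▸ hκ)
      obtain ⟨ν, hν⟩ := exists_mahlerMeasure_mul_predErrSq_le hf0 hfi hfg h1
      exact ⟨ν, fun n => (mul_le_mul_of_nonneg_right h2 (predErrSq_nonneg hf0 _)).trans (hν n)⟩
    · have hfg0 : ∀ᵐ x ∂(volume.restrict Lam), 0 ≤ f x * g x := by
        filter_upwards [hf0, hg] with x h1 h2 using mul_nonneg h1 h2.le
      have h3 : (geomMean g)⁻¹ =
          Real.exp ((1 / (2 * Real.pi)) * ∫ x in Lam, Real.log (g x)⁻¹) := by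
        rw [hG, ← Real.exp_neg]
        simp [Real.log_inv, integral_neg]
      obtain ⟨Q, h1, h2⟩ := hup.exists_lt_mahlerMeasure (h3 ▸ hκ)
      obtain ⟨ν, hν⟩ := exists_mahlerMeasure_mul_predErrSq_mul_le (Q := Q) hf0
        (hg.mono fun x hx => hx.le) hfi hfg (by
          filter_upwards [h1, hg] with x h4 h5
          calc _ ≤ (g x)⁻¹ * g x := by gcongr
            _ = 1 := inv_mul_cancel₀ h5.ne')
      exact ⟨ν, fun n => (mul_le_mul_of_nonneg_right h2 (predErrSq_nonneg hfg0 _)).trans (hν n)⟩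
  have hfg0 : ∀ᵐ x ∂(volume.restrict Lam), 0 ≤ f x * g x := by
    filter_upwards [hf0, hg] with x h1 h2 using mul_nonneg h1 h2.le
  refine ⟨⟨hg0, hGpos, hfg, hlim⟩, hfg, hfg0, geomMean_mul_eq_zero hfG hg hlog, ?_⟩
  have h1 : Tendsto (fun n : ℕ => predErr (fun x => f x * g x) n / predErr f n) atTop
      (𝓝 √(geomMean g)) := by
    refine ((Real.continuous_sqrt.tendsto _).comp hlim).congr fun n => ?_
    simp only [Function.comp_apply, predErr]
    exact Real.sqrt_div (predErrSq_nonneg hfg0 n) _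
  -- With `r_n = σ_n(fg) / σ_n(f)`, the ratio of successive errors of `fg` is `(r_{n+1} / r_n) ·
  -- σ_{n+1}(f) / σ_n(f)`.
  have h2 := (((tendsto_add_atTop_iff_nat 1).2 h1).div h1 (Real.sqrt_pos.2 hGpos).ne').mul hfv
  rw [div_self (Real.sqrt_pos.2 hGpos).ne', one_mul] at h2
  refine h2.congr' ?_
  have hp : ∀ᶠ n in atTop, 0 < predErr f n := hpos.mono fun n hn => Real.sqrt_pos.2 hn
  filter_upwards [hp, (tendsto_add_atTop_nat 1).eventually hp] with n h3 h4
  simp only [Pi.div_apply]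
  rw [div_div_div_eq, div_mul_div_comm]
  rw [mul_assoc, mul_comm (predErr f (n + 1)), mul_assoc, mul_comm (predErr f (n + 1)),
    mul_div_mul_right _ _ (mul_pos h3 h4).ne']

/-! ### Riemann integrable functions are continuous almost everywhere -/

instance {a b : ℝ} [h : Fact (a ≤ b)] : Nonempty (IntervalPartition a b) :=
  ⟨{ n := 1
     pt := fun i => if i = 0 then a else b
     mono := by
       intro i j hij
       by_cases hi : i = 0
       · by_cases hj : j = 0 <;> simp [hi, hj, h.out]
       · simp [hi, show j ≠ 0 by omega]
     first := by simp
     last := by simp }⟩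

/-- The step function with the value `v i` on the `i`-th interval of a partition. -/
def stepFun {a b : ℝ} (P : IntervalPartition a b) (v : ℕ → ℝ) (x : ℝ) : ℝ :=
  ∑ i ∈ Finset.range P.n, (Set.Ioc (P.pt i) (P.pt (i + 1))).indicator (fun _ => v i) x

section StepFun

variable {a b : ℝ} (P : IntervalPartition a b) (v : ℕ → ℝ)

lemma measurable_stepFun : Measurable (stepFun P v) :=
  Finset.measurable_fun_sum _ fun _ _ => measurable_const.indicator measurableSet_Ioc

lemma integrable_indicator_Ioc (c d r : ℝ) :
    Integrable ((Set.Ioc c d).indicator fun _ : ℝ => r) :=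
  (integrable_indicator_iff measurableSet_Ioc).2
    (integrableOn_const (by simp) (by simp))

lemma integrable_stepFun : Integrable (stepFun P v) :=
  integrable_finsetSum _ fun _ _ => integrable_indicator_Ioc _ _ _

lemma integral_stepFun :
    ∫ x, stepFun P v x = ∑ i ∈ Finset.range P.n, v i * (P.pt (i + 1) - P.pt i) := by
  unfold stepFun
  rw [integral_finsetSum _ fun _ _ => integrable_indicator_Ioc _ _ _]
  refine Finset.sum_congr rfl fun i _ => ?_
  rw [integral_indicator measurableSet_Ioc, setIntegral_const, measureReal_def, Real.volume_Ioc,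
    ENNReal.toReal_ofReal (sub_nonneg.2 (P.mono (Nat.le_succ i))), smul_eq_mul, mul_comm]

lemma IntervalPartition.le_pt (i : ℕ) : a ≤ P.pt i :=
  P.first.symm.trans_le (P.mono (Nat.zero_le i))

lemma IntervalPartition.pt_le {i : ℕ} (hi : i ≤ P.n) : P.pt i ≤ b :=
  (P.mono hi).trans_eq P.last

lemma stepFun_eq_zero {x : ℝ} (hx : x ∉ Set.Ioc a b) : stepFun P v x = 0 := by
  refine Finset.sum_eq_zero fun i hi => Set.indicator_of_notMem (fun h => hx ?_) _
  exact ⟨(P.le_pt i).trans_lt h.1, h.2.trans (P.pt_le (Finset.mem_range.1 hi))⟩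

/-- Off the division points, `x` is interior to a cell, so a supremum or infimum over that cell
bounds a function on a whole neighbourhood of `x`. -/
lemma exists_stepFun_eq {x : ℝ} (hx : x ∈ Set.Ioo a b) (hx' : x ∉ Set.range P.pt) :
    ∃ i, a ≤ P.pt i ∧ P.pt (i + 1) ≤ b ∧ x ∈ Set.Ioo (P.pt i) (P.pt (i + 1)) ∧
      stepFun P v x = v i := by
  classical
  have hex : ∃ j, x ≤ P.pt j := ⟨P.n, P.last.symm ▸ hx.2.le⟩
  obtain ⟨j, hj, hmin⟩ : ∃ j, x ≤ P.pt j ∧ ∀ m < j, ¬ x ≤ P.pt m :=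
    ⟨Nat.find hex, Nat.find_spec hex, fun m hm => Nat.find_min hex hm⟩
  have hj0 : j ≠ 0 := by
    rintro rfl
    rw [P.first] at hj
    exact absurd hx.1 (not_lt.2 hj)
  obtain ⟨i, rfl⟩ := Nat.exists_eq_succ_of_ne_zero hj0
  have hi : P.pt i < x := not_le.1 (hmin i (Nat.lt_succ_self i))
  have hin : i < P.n := by
    by_contra h
    exact absurd (hi.trans hx.2) (not_lt.2 (P.last.symm.trans_le (P.mono (not_lt.1 h))))
  refine ⟨i, P.le_pt i, P.pt_le hin, ⟨hi, lt_of_le_of_ne hj ?_⟩, ?_⟩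
  · rintro rfl
    exact hx' ⟨_, rfl⟩
  · rw [stepFun, Finset.sum_eq_single i]
    · rw [Set.indicator_of_mem]
      exact ⟨hi, hj⟩
    · intro k _ hk
      refine Set.indicator_of_notMem (fun h => ?_) _
      exact Set.disjoint_left.1 (P.mono.pairwise_disjoint_on_Ioc_succ hk) h ⟨hi, hj⟩
    · exact fun h => absurd (Finset.mem_range.2 hin) h

end StepFun

/-- A Riemann integrable function is continuous almost everywhere. -/
theorem IsRiemannIntegrable.ae_continuousAt {h : ℝ → ℝ} {a b : ℝ} (hab : a ≤ b)
    (hh : IsRiemannIntegrable h a b) :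
    ∀ᵐ x ∂(volume.restrict (Set.Icc a b)), ContinuousAt h x := by
  have : Fact (a ≤ b) := ⟨hab⟩
  obtain ⟨hA, hB, hI⟩ := hh
  set I := ⨅ P : IntervalPartition a b, upperSum h P with hIdef
  -- Upper and lower partitions are chosen independently; comparing the step functions pointwise
  -- makes a common refinement unnecessary.
  have hP : ∀ k : ℕ, ∃ P : IntervalPartition a b, upperSum h P < I + 1 / ((k : ℝ) + 1) := fun k =>
    exists_lt_of_ciInf_lt (lt_add_of_pos_right I Nat.one_div_pos_of_nat)
  have hP' : ∀ k : ℕ, ∃ P : IntervalPartition a b, I - 1 / ((k : ℝ) + 1) < lowerSum h P := fun k =>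
    exists_lt_of_lt_ciSup (by rw [← hI]; exact sub_lt_self I Nat.one_div_pos_of_nat)
  choose P hP using hP
  choose P' hP' using hP'
  let u (k : ℕ) : ℝ → ℝ := stepFun (P k) fun i => sSup (h '' Set.Icc ((P k).pt i) ((P k).pt (i + 1)))
  let l (k : ℕ) : ℝ → ℝ :=
    stepFun (P' k) fun i => sInf (h '' Set.Icc ((P' k).pt i) ((P' k).pt (i + 1)))
  have hu : ∀ k x, x ∈ Set.Ioo a b → x ∉ Set.range (P k).pt → ∀ᶠ y in 𝓝 x, h y ≤ u k x := by
    intro k x hx hx'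
    obtain ⟨i, h1, h2, h3, h4⟩ := exists_stepFun_eq (P k)
      (fun i => sSup (h '' Set.Icc ((P k).pt i) ((P k).pt (i + 1)))) hx hx'
    filter_upwards [Ioo_mem_nhds h3.1 h3.2] with y hy
    change h y ≤ stepFun _ _ x
    rw [h4]
    exact le_csSup (hA.mono (Set.image_mono (Set.Icc_subset_Icc h1 h2)))
      ⟨y, Set.Ioo_subset_Icc_self hy, rfl⟩
  have hl : ∀ k x, x ∈ Set.Ioo a b → x ∉ Set.range (P' k).pt → ∀ᶠ y in 𝓝 x, l k x ≤ h y := by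
    intro k x hx hx'
    obtain ⟨i, h1, h2, h3, h4⟩ := exists_stepFun_eq (P' k)
      (fun i => sInf (h '' Set.Icc ((P' k).pt i) ((P' k).pt (i + 1)))) hx hx'
    filter_upwards [Ioo_mem_nhds h3.1 h3.2] with y hy
    change stepFun _ _ x ≤ h y
    rw [h4]
    exact csInf_le (hB.mono (Set.image_mono (Set.Icc_subset_Icc h1 h2)))
      ⟨y, Set.Ioo_subset_Icc_self hy, rfl⟩
  have hcount : ({a, b} ∪ ⋃ k, (Set.range (P k).pt ∪ Set.range (P' k).pt)).Countable :=
    (Set.toFinite _).countable.union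
      (Set.countable_iUnion fun k => (Set.countable_range _).union (Set.countable_range _))
  have hgen : ∀ᵐ x : ℝ, x ∉ {a, b} ∪ ⋃ k, (Set.range (P k).pt ∪ Set.range (P' k).pt) :=
    (hcount.ae_notMem volume)
  have hint : ∀ k, ∫ x, (u k x - l k x) ≤ 2 / ((k : ℝ) + 1) := by
    intro k
    rw [integral_sub (integrable_stepFun _ _) (integrable_stepFun _ _), integral_stepFun,
      integral_stepFun]
    have h1 := hP k
    have h2 := hP' k
    simp only [upperSum, lowerSum] at h1 h2
    have : 2 / ((k : ℝ) + 1) = 1 / ((k : ℝ) + 1) + 1 / ((k : ℝ) + 1) := by ring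
    linarith
  have hnonneg : ∀ k, 0 ≤ᵐ[volume] fun x => u k x - l k x := by
    intro k
    filter_upwards [hgen] with x hx
    simp only [Set.mem_union, Set.mem_insert_iff, Set.mem_singleton_iff, Set.mem_iUnion,
      not_or, not_exists] at hx
    by_cases hx' : x ∈ Set.Ioo a b
    · exact sub_nonneg.2 (((hl k x hx' (hx.2 k).2).self_of_nhds).trans
        (hu k x hx' (hx.2 k).1).self_of_nhds)
    · have : x ∉ Set.Ioc a b := fun h => hx' ⟨h.1, lt_of_le_of_ne h.2 hx.1.2⟩
      simp [u, l, stepFun_eq_zero _ _ this]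
  have hmeas : Measurable fun x => ⨅ k, ENNReal.ofReal (u k x - l k x) :=
    Measurable.iInf fun k => ((measurable_stepFun _ _).sub (measurable_stepFun _ _)).ennreal_ofReal
  -- The gap `u k x - l k x` bounds the oscillation of `h` at generic `x`; its integral is at most
  -- `2 / (k + 1)`, so the infimum of the gaps vanishes almost everywhere.
  have hzero : ∀ᵐ x : ℝ, ⨅ k, ENNReal.ofReal (u k x - l k x) = 0 := by
    refine (lintegral_eq_zero_iff hmeas).1 (le_antisymm ?_ zero_le)
    have hlim : Tendsto (fun k : ℕ => ENNReal.ofReal (2 / ((k : ℝ) + 1))) atTop (𝓝 0) := by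
      have := ENNReal.tendsto_ofReal ((tendsto_one_div_add_atTop_nhds_zero_nat (𝕜 := ℝ)).const_mul 2)
      simpa only [mul_one_div, mul_zero, ENNReal.ofReal_zero] using this
    refine ge_of_tendsto' hlim fun k => ?_
    calc _ ≤ ∫⁻ x, ENNReal.ofReal (u k x - l k x) := lintegral_mono fun x => iInf_le _ k
      _ = ENNReal.ofReal (∫ x, (u k x - l k x)) :=
        (ofReal_integral_eq_lintegral_ofReal
          ((integrable_stepFun _ _).sub (integrable_stepFun _ _)) (hnonneg k)).symm
      _ ≤ _ := ENNReal.ofReal_le_ofReal (hint k)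
  rw [ae_restrict_iff' measurableSet_Icc]
  filter_upwards [hgen, hzero] with x hx hx0 hxab
  simp only [Set.mem_union, Set.mem_insert_iff, Set.mem_singleton_iff, Set.mem_iUnion,
    not_or, not_exists] at hx
  have hx' : x ∈ Set.Ioo a b :=
    ⟨lt_of_le_of_ne hxab.1 (Ne.symm hx.1.1), lt_of_le_of_ne hxab.2 hx.1.2⟩
  refine Metric.continuousAt_iff'.2 fun ε hε => ?_
  obtain ⟨k, hk⟩ : ∃ k, ENNReal.ofReal (u k x - l k x) < ENNReal.ofReal ε :=
    iInf_lt_iff.1 (hx0.symm ▸ ENNReal.ofReal_pos.2 hε)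
  have hk' := (ENNReal.ofReal_lt_ofReal_iff hε).1 hk
  have h1 := hu k x hx' (hx.2 k).1
  have h2 := hl k x hx' (hx.2 k).2
  filter_upwards [h1, h2] with y h3 h4
  have h5 := h1.self_of_nhds
  have h6 := h2.self_of_nhds
  rw [Real.dist_eq, abs_lt]
  constructor <;> linarith

/-! ### Continuous minorants -/

section Envelope

/-- The largest `k`-Lipschitz minorant of `ψ`. -/
def lipEnvelope (ψ : ℝ → ℝ) (k : ℕ) (x : ℝ) : ℝ := ⨅ y, (ψ y + k * |x - y|)

variable {ψ : ℝ → ℝ} {C : ℝ}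

lemma bddBelow_lipEnvelope (hψ : ∀ x, |ψ x| ≤ C) (k : ℕ) (x : ℝ) :
    BddBelow (Set.range fun y => ψ y + k * |x - y|) := by
  refine ⟨-C, ?_⟩
  rintro _ ⟨y, rfl⟩
  have h1 := (abs_le.1 (hψ y)).1
  have h2 : 0 ≤ (k : ℝ) * |x - y| := by positivity
  simp only
  linarith

lemma lipEnvelope_le (hψ : ∀ x, |ψ x| ≤ C) (k : ℕ) (x : ℝ) : lipEnvelope ψ k x ≤ ψ x :=
  (ciInf_le (bddBelow_lipEnvelope hψ k x) x).trans (by simp)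

lemma neg_le_lipEnvelope (hψ : ∀ x, |ψ x| ≤ C) (k : ℕ) (x : ℝ) : -C ≤ lipEnvelope ψ k x := by
  refine le_ciInf fun y => ?_
  have h1 := (abs_le.1 (hψ y)).1
  have h2 : 0 ≤ (k : ℝ) * |x - y| := by positivity
  linarith

lemma continuous_lipEnvelope (hψ : ∀ x, |ψ x| ≤ C) (k : ℕ) : Continuous (lipEnvelope ψ k) := by
  refine (LipschitzWith.of_le_add_mul (k : NNReal) fun x x' => ?_).continuous
  rw [← sub_le_iff_le_add]
  refine le_ciInf fun y => ?_
  have h1 := ciInf_le (bddBelow_lipEnvelope hψ k x) y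
  have h2 := mul_le_mul_of_nonneg_left (abs_sub_le x x' y) (Nat.cast_nonneg (α := ℝ) k)
  rw [Real.dist_eq, NNReal.coe_natCast]
  simp only [lipEnvelope] at *
  linarith

lemma tendsto_lipEnvelope (hψ : ∀ x, |ψ x| ≤ C) {x : ℝ} (hx : ContinuousAt ψ x) :
    Tendsto (fun k => lipEnvelope ψ k x) atTop (𝓝 (ψ x)) := by
  refine tendsto_order.2 ⟨fun c hc => ?_, fun c hc =>
    Eventually.of_forall fun k => (lipEnvelope_le hψ k x).trans_lt hc⟩
  obtain ⟨c', h1, h2⟩ := exists_between hc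
  obtain ⟨δ, hδ, hball⟩ := Metric.eventually_nhds_iff.1 (hx.eventually (lt_mem_nhds h2))
  have hlim : Tendsto (fun k : ℕ => (k : ℝ) * δ) atTop atTop :=
    tendsto_natCast_atTop_atTop.atTop_mul_const hδ
  -- For such `k`, points at distance at least `δ` pay a penalty that outweighs `ψ y ≥ -C`; nearer
  -- points are covered by continuity.
  filter_upwards [hlim.eventually_ge_atTop (C + ψ x)] with k hk
  refine h1.trans_le (le_ciInf fun y => ?_)
  by_cases hy : dist y x < δ
  · have h3 := hball hy
    have h4 : 0 ≤ (k : ℝ) * |x - y| := by positivity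
    linarith
  · rw [not_lt, dist_comm, Real.dist_eq] at hy
    have h3 := mul_le_mul_of_nonneg_left hy (Nat.cast_nonneg (α := ℝ) k)
    have h4 := (abs_le.1 (hψ y)).1
    linarith

end Envelope

lemma ae_mem_Ioo : ∀ᵐ x ∂(volume.restrict Lam), x ∈ Set.Ioo (-Real.pi) Real.pi := by
  rw [Lam, ← restrict_Ioo_eq_restrict_Icc]
  exact ae_restrict_mem measurableSet_Ioo

instance : IsFiniteMeasure (volume.restrict Lam) :=
  ⟨by simp [Lam]⟩

/-- A bounded, almost everywhere continuous function on `Λ` is the almost everywhere limit of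
continuous minorants that take equal values at the end points. -/
lemma exists_continuous_minorants {ψ : ℝ → ℝ} {C : ℝ} (hC : ∀ x ∈ Lam, |ψ x| ≤ C)
    (hψ : ∀ᵐ x ∂(volume.restrict Lam), ContinuousAt ψ x) :
    ∃ χ : ℕ → ℝ → ℝ, (∀ k, Continuous (χ k)) ∧ (∀ k, χ k (-Real.pi) = χ k Real.pi) ∧
      (∀ k x, |χ k x| ≤ C) ∧ (∀ k, ∀ᵐ x ∂(volume.restrict Lam), χ k x ≤ ψ x) ∧
      ∀ᵐ x ∂(volume.restrict Lam), Tendsto (fun k => χ k x) atTop (𝓝 (ψ x)) := by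
  classical
  have hC0 : 0 ≤ C := (abs_nonneg _).trans (hC 0 ⟨by linarith [Real.pi_pos], Real.pi_pos.le⟩)
  -- The value `-C` off the open interval forces every envelope to equal `-C` at both end points,
  -- hence to be periodic.
  set φ : ℝ → ℝ := (Set.Ioo (-Real.pi) Real.pi).piecewise ψ fun _ => -C with hφ
  have hφC : ∀ x, |φ x| ≤ C := by
    intro x
    by_cases hx : x ∈ Set.Ioo (-Real.pi) Real.pi
    · simpa [hφ, hx] using hC x (Set.Ioo_subset_Icc_self hx)
    · simp [hφ, hx, abs_of_nonneg hC0]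
  have hend : ∀ k x, x ∉ Set.Ioo (-Real.pi) Real.pi → lipEnvelope φ k x = -C := fun k x hx =>
    le_antisymm ((lipEnvelope_le hφC k x).trans_eq (Set.piecewise_eq_of_notMem _ _ _ hx))
      (neg_le_lipEnvelope hφC k x)
  refine ⟨lipEnvelope φ, continuous_lipEnvelope hφC, fun k => ?_, fun k x => abs_le.2 ⟨?_, ?_⟩,
    fun k => ?_, ?_⟩
  · rw [hend k _ (by simp), hend k _ (by simp)]
  · exact neg_le_lipEnvelope hφC k x
  · exact (lipEnvelope_le hφC k x).trans (abs_le.1 (hφC x)).2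
  · filter_upwards [ae_mem_Ioo] with x hx
    exact (lipEnvelope_le hφC k x).trans_eq (Set.piecewise_eq_of_mem _ _ _ hx)
  · filter_upwards [ae_mem_Ioo, hψ] with x hx hcont
    have h1 : φ =ᶠ[𝓝 x] ψ := by
      filter_upwards [isOpen_Ioo.mem_nhds hx] with y hy
      exact Set.piecewise_eq_of_mem _ _ _ hy
    rw [← h1.self_of_nhds]
    exact tendsto_lipEnvelope hφC (hcont.congr h1.symm)

lemma aestronglyMeasurable_of_ae_continuousAt {ψ : ℝ → ℝ} {C : ℝ} (hC : ∀ x ∈ Lam, |ψ x| ≤ C)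
    (hψ : ∀ᵐ x ∂(volume.restrict Lam), ContinuousAt ψ x) :
    AEStronglyMeasurable ψ (volume.restrict Lam) := by
  obtain ⟨χ, h1, -, -, -, h2⟩ := exists_continuous_minorants hC hψ
  exact aestronglyMeasurable_of_tendsto_ae atTop (fun k => (h1 k).aestronglyMeasurable) h2

lemma integrableOn_of_ae_continuousAt {ψ : ℝ → ℝ} {C : ℝ} (hC : ∀ x ∈ Lam, |ψ x| ≤ C)
    (hψ : ∀ᵐ x ∂(volume.restrict Lam), ContinuousAt ψ x) : IntegrableOn ψ Lam :=
  Integrable.of_bound (aestronglyMeasurable_of_ae_continuousAt hC hψ) C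
    ((ae_restrict_mem measurableSet_Icc).mono fun x hx => hC x hx)

lemma exists_continuous_minorant {ψ : ℝ → ℝ} {C : ℝ} (hC : ∀ x ∈ Lam, |ψ x| ≤ C)
    (hψ : ∀ᵐ x ∂(volume.restrict Lam), ContinuousAt ψ x) {ε : ℝ} (hε : 0 < ε) :
    ∃ χ : ℝ → ℝ, Continuous χ ∧ χ (-Real.pi) = χ Real.pi ∧ (∀ x, |χ x| ≤ C) ∧
      (∀ᵐ x ∂(volume.restrict Lam), χ x ≤ ψ x) ∧
      (∫ x in Lam, ψ x) - ε < ∫ x in Lam, χ x := by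
  obtain ⟨χ, h1, h2, h3, h4, h5⟩ := exists_continuous_minorants hC hψ
  have hlim : Tendsto (fun k => ∫ x in Lam, χ k x) atTop (𝓝 (∫ x in Lam, ψ x)) :=
    tendsto_integral_of_dominated_convergence (fun _ => C)
      (fun k => (h1 k).aestronglyMeasurable) (integrable_const C)
      (fun k => Eventually.of_forall fun x => h3 k x) h5
  obtain ⟨k, hk⟩ := (hlim.eventually (lt_mem_nhds (sub_lt_self _ hε))).exists
  exact ⟨χ k, h1 k, h2 k, h3 k, h4 k, hk⟩

/-! ### Laurent polynomials and approximation on the circle -/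

section Fourier

lemma fact_two_pi : Fact (0 < 2 * Real.pi) := ⟨Real.two_pi_pos⟩

attribute [local instance] fact_two_pi

lemma circleMap_zero_one (x : ℝ) : circleMap 0 1 x = Complex.exp (x * Complex.I) := by
  simp [circleMap]

/-- `F` is a Laurent polynomial in `e^{iλ}`. -/
def IsLaurent (F : ℝ → ℂ) : Prop :=
  ∃ (N : ℕ) (Q : ℂ[X]), ∀ x : ℝ, circleMap 0 1 x ^ N * F x = Q.eval (circleMap 0 1 x)

lemma isLaurent_zpow (n : ℤ) : IsLaurent fun x => circleMap 0 1 x ^ n := by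
  refine ⟨n.natAbs, X ^ ((n.natAbs : ℤ) + n).toNat, fun x => ?_⟩
  have h0 : circleMap 0 1 x ≠ 0 := circleMap_ne_center one_ne_zero
  have h2 : (((n.natAbs : ℤ) + n).toNat : ℤ) = n.natAbs + n := Int.toNat_of_nonneg (by omega)
  rw [eval_pow, eval_X, ← zpow_natCast, ← zpow_natCast, ← zpow_add₀ h0, h2]

lemma IsLaurent.add {F G : ℝ → ℂ} (hF : IsLaurent F) (hG : IsLaurent G) :
    IsLaurent fun x => F x + G x := by
  obtain ⟨N, Q, hQ⟩ := hF
  obtain ⟨M, R, hR⟩ := hG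
  refine ⟨N + M, X ^ M * Q + X ^ N * R, fun x => ?_⟩
  simp only [eval_add, eval_mul, eval_pow, eval_X, ← hQ, ← hR]
  ring

lemma IsLaurent.const_mul {F : ℝ → ℂ} (hF : IsLaurent F) (c : ℂ) :
    IsLaurent fun x => c * F x := by
  obtain ⟨N, Q, hQ⟩ := hF
  refine ⟨N, C c * Q, fun x => ?_⟩
  simp only [eval_mul, eval_C, ← hQ]
  ring

lemma isLaurent_zero : IsLaurent fun _ => 0 := ⟨0, 0, by simp⟩

lemma IsLaurent.sum {ι : Type*} (S : Finset ι) {F : ι → ℝ → ℂ} (hF : ∀ i ∈ S, IsLaurent (F i)) :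
    IsLaurent fun x => ∑ i ∈ S, F i x := by
  classical
  induction S using Finset.induction with
  | empty => simpa using isLaurent_zero
  | insert i S hi ih =>
    simp only [Finset.sum_insert hi]
    exact (hF i (Finset.mem_insert_self i S)).add
      (ih fun j hj => hF j (Finset.mem_insert_of_mem hj))

lemma IsLaurent.exists_polynomial_norm_eq {F : ℝ → ℂ} (hF : IsLaurent F) :
    ∃ Q : ℂ[X], ∀ x : ℝ, ‖Q.eval (circleMap 0 1 x)‖ = ‖F x‖ := by
  obtain ⟨N, Q, hQ⟩ := hF
  exact ⟨Q, fun x => by simp [← hQ]⟩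

lemma IsTrigPoly.isLaurent {t : ℝ → ℝ} (ht : IsTrigPoly t) : IsLaurent fun x => (t x : ℂ) := by
  obtain ⟨ν, a, b, h⟩ := ht
  have hterm : ∀ k : ℕ, IsLaurent fun x => (a k / 2 + b k / (2 * Complex.I)) * circleMap 0 1 x ^ (k : ℤ)
      + (a k / 2 - b k / (2 * Complex.I)) * circleMap 0 1 x ^ (-k : ℤ) := fun k =>
    ((isLaurent_zpow k).const_mul _).add ((isLaurent_zpow (-k)).const_mul _)
  have h0 := ((isLaurent_zpow 0).const_mul (a 0 : ℂ)).add
    (IsLaurent.sum (Finset.Icc 1 ν) fun k _ => hterm k)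
  convert h0 using 2 with x
  rw [h x]
  push_cast
  rw [zpow_zero, mul_one]
  congr 1
  refine Finset.sum_congr rfl fun k _ => ?_
  rw [circleMap_zero_one, ← Complex.exp_int_mul, ← Complex.exp_int_mul, Complex.cos, Complex.sin]
  push_cast
  rw [show (k : ℂ) * (x * Complex.I) = k * x * Complex.I by ring,
    show -(k : ℂ) * (x * Complex.I) = -(k * x) * Complex.I by ring]
  have hI : (1 : ℂ) / Complex.I = -Complex.I := by simp
  rw [show (b k : ℂ) / (2 * Complex.I) = b k / 2 * (1 / Complex.I) by field_simp, hI]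
  ring

/-- Multiplication by a power of `e^{iλ}` preserves the modulus. Representing `|t|` by `|Q|`, rather
than `t` by `|Q|²`, avoids the Fejér–Riesz theorem. -/
lemma exists_polynomial_norm_eq_abs {t : ℝ → ℝ} (ht : IsTrigPoly t) (h0 : t ≠ 0) :
    ∃ Q : ℂ[X], Q ≠ 0 ∧ ∀ x : ℝ, ‖Q.eval (circleMap 0 1 x)‖ = |t x| := by
  obtain ⟨Q, hQ⟩ := ht.isLaurent.exists_polynomial_norm_eq
  simp only [Complex.norm_real, Real.norm_eq_abs] at hQ
  refine ⟨Q, ?_, hQ⟩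
  rintro rfl
  exact h0 (funext fun x => by simpa [eq_comm] using hQ x)

lemma isLaurent_of_mem_span {F : C(AddCircle (2 * Real.pi), ℂ)}
    (hF : F ∈ Submodule.span ℂ (Set.range (@fourier (2 * Real.pi)))) :
    IsLaurent fun x => F (x : AddCircle (2 * Real.pi)) := by
  induction hF using Submodule.span_induction with
  | mem F hF =>
    obtain ⟨n, rfl⟩ := hF
    convert isLaurent_zpow n using 2 with x
    rw [fourier_coe_apply, circleMap_zero_one, ← Complex.exp_int_mul]
    congr 1
    have := Complex.ofReal_ne_zero.2 Real.pi_ne_zero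
    push_cast
    field_simp
  | zero => exact isLaurent_zero
  | add F G _ _ hF hG => exact hF.add hG
  | smul c F _ hF => exact hF.const_mul c

/-- Moduli of polynomials on the unit circle are uniformly dense in the nonnegative continuous
functions. -/
lemma exists_polynomial_norm_approx {χ : ℝ → ℝ} (hχ : Continuous χ)
    (hend : χ (-Real.pi) = χ Real.pi) (h0 : ∀ x, 0 ≤ χ x) {ε : ℝ} (hε : 0 < ε) :
    ∃ Q : ℂ[X], ∀ x ∈ Set.Ioo (-Real.pi) Real.pi, |‖Q.eval (circleMap 0 1 x)‖ - χ x| < ε := by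
  have hpi : -Real.pi + 2 * Real.pi = Real.pi := by ring
  let G : C(AddCircle (2 * Real.pi), ℂ) :=
    ⟨AddCircle.liftIco (2 * Real.pi) (-Real.pi) fun x => (χ x : ℂ),
      AddCircle.liftIco_continuous (by rw [hpi, hend])
        (Complex.continuous_ofReal.comp hχ).continuousOn⟩
  have hG : G ∈ (Submodule.span ℂ (Set.range (@fourier (2 * Real.pi)))).topologicalClosure := by
    rw [span_fourier_closure_eq_top]; trivial
  obtain ⟨F, hF, hFG⟩ := Metric.mem_closure_iff.1 hG ε hε
  obtain ⟨Q, hQ⟩ := (isLaurent_of_mem_span hF).exists_polynomial_norm_eq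
  refine ⟨Q, fun x hx => ?_⟩
  have h2 : G (x : AddCircle (2 * Real.pi)) = (χ x : ℂ) :=
    AddCircle.liftIco_coe_apply (f := fun x => (χ x : ℂ)) (by rw [hpi]; exact Set.Ioo_subset_Ico_self hx)
  have h3 : ‖G (x : AddCircle (2 * Real.pi))‖ = χ x := by
    rw [h2, Complex.norm_real, Real.norm_of_nonneg (h0 x)]
  rw [hQ, ← h3]
  refine (abs_norm_sub_norm_le _ _).trans_lt (lt_of_le_of_lt ?_ hFG)
  rw [dist_comm, dist_eq_norm]
  exact (F - G).norm_coe_le_norm _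

end Fourier

/-! ### Mahler measure as a logarithmic mean over `Λ` -/

section LogMahler

lemma integrableOn_log_norm_eval (Q : ℂ[X]) :
    IntegrableOn (fun x => Real.log ‖Q.eval (circleMap 0 1 x)‖) Lam := by
  have hper : Function.Periodic (fun x => Real.log ‖Q.eval (circleMap 0 1 x)‖) (2 * Real.pi) :=
    (periodic_circleMap 0 1).comp fun z => Real.log ‖Q.eval z‖
  have h := hper.intervalIntegrable₀ Real.two_pi_pos.ne' Q.intervalIntegrable_mahlerMeasure
    (-Real.pi) Real.pi
  rwa [intervalIntegrable_iff_integrableOn_Icc_of_le (by linarith [Real.pi_pos])] at h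

lemma logMahlerMeasure_eq_integral (Q : ℂ[X]) : Q.logMahlerMeasure =
    (1 / (2 * Real.pi)) * ∫ x in Lam, Real.log ‖Q.eval (circleMap 0 1 x)‖ := by
  have hper : Function.Periodic (fun x => Real.log ‖Q.eval (circleMap 0 1 x)‖) (2 * Real.pi) :=
    (periodic_circleMap 0 1).comp fun z => Real.log ‖Q.eval z‖
  have h := hper.intervalIntegral_add_eq 0 (-Real.pi)
  rw [zero_add, show -Real.pi + 2 * Real.pi = Real.pi by ring] at h
  rw [logMahlerMeasure_def, Real.circleAverage_def, smul_eq_mul, h,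
    intervalIntegral.integral_of_le (by linarith [Real.pi_pos]), Lam,
    integral_Icc_eq_integral_Ioc, one_div]

lemma ae_norm_eval_pos {Q : ℂ[X]} (hQ : Q ≠ 0) :
    ∀ᵐ x ∂(volume.restrict Lam), 0 < ‖Q.eval (circleMap 0 1 x)‖ := by
  have h1 : (circleMap 0 1 ⁻¹' {z | Q.IsRoot z}).Countable :=
    (Polynomial.finite_setOfPred_isRoot hQ).countable.preimage_circleMap 0 one_ne_zero
  filter_upwards [ae_restrict_of_ae (h1.ae_notMem volume)] with x hx
  exact norm_pos_iff.2 hx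

end LogMahler

/-! ### Minorization of weights between positive constants -/

lemma integral_const_Lam (r : ℝ) : ∫ _ in Lam, r = 2 * Real.pi * r := by
  rw [setIntegral_const, Lam, measureReal_def, Real.volume_Icc,
    ENNReal.toReal_ofReal (by linarith [Real.pi_pos]), smul_eq_mul]
  ring

lemma abs_log_le_of_mem {m M y : ℝ} (hm : 0 < m) (h1 : m ≤ y) (h2 : y ≤ M) :
    |Real.log y| ≤ |Real.log m| + |Real.log M| := by
  have h3 := Real.log_le_log hm h1
  have h4 := Real.log_le_log (hm.trans_le h1) h2
  exact abs_le.2 ⟨by linarith [neg_abs_le (Real.log m), abs_nonneg (Real.log M)],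
    by linarith [le_abs_self (Real.log M), abs_nonneg (Real.log m)]⟩

section Bounded

variable {w : ℝ → ℝ} {m M : ℝ}

lemma ae_continuousAt_log (hm : 0 < m) (hw : ∀ x ∈ Lam, m ≤ w x ∧ w x ≤ M)
    (hc : ∀ᵐ x ∂(volume.restrict Lam), ContinuousAt w x) :
    ∀ᵐ x ∂(volume.restrict Lam), ContinuousAt (fun x => Real.log (w x)) x := by
  filter_upwards [hc, ae_restrict_mem measurableSet_Icc] with x hx hxL
  exact hx.log (hm.trans_le (hw x hxL).1).ne'

lemma integrableOn_log_of_ae_continuousAt (hm : 0 < m) (hw : ∀ x ∈ Lam, m ≤ w x ∧ w x ≤ M)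
    (hc : ∀ᵐ x ∂(volume.restrict Lam), ContinuousAt w x) :
    IntegrableOn (fun x => Real.log (w x)) Lam :=
  integrableOn_of_ae_continuousAt (fun x hx => abs_log_le_of_mem hm (hw x hx).1 (hw x hx).2)
    (ae_continuousAt_log hm hw hc)

/-- A function that is continuous almost everywhere and lies between positive constants is
approximated from below, in geometric mean, by squared moduli of polynomials. -/
lemma polyMinorized_of_ae_continuousAt (hm : 0 < m) (hw : ∀ x ∈ Lam, m ≤ w x ∧ w x ≤ M)
    (hc : ∀ᵐ x ∂(volume.restrict Lam), ContinuousAt w x) : PolyMinorized w := by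
  intro ε hε
  set C := |Real.log m| + |Real.log M|
  obtain ⟨χ, hχ, hend, hχC, hχw, hχint⟩ := exists_continuous_minorant
    -- Of the total loss `2πε` in the integral of `log w`, half goes to this minorant and half to
    -- the choice `δ = ε / 8`.
    (fun x hx => abs_log_le_of_mem hm (hw x hx).1 (hw x hx).2) (ae_continuousAt_log hm hw hc)
    (mul_pos Real.pi_pos hε)
  set δ := ε / 8 with hδ
  have hδ0 : 0 < δ := by positivity
  -- The target is `e^{χ/2 - δ}`; an error below this `η`, uniform because `χ ≥ -C`, keeps `‖Q‖`
  -- between `e^{χ/2 - 2δ}` and `e^{χ/2}`.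
  set η := Real.exp (-C / 2) * (Real.exp (-δ) * (1 - Real.exp (-δ))) with hη
  have h1δ : 0 < 1 - Real.exp (-δ) := by
    rw [sub_pos, ← Real.exp_zero]
    exact Real.exp_lt_exp.2 (by linarith)
  have hη0 : 0 < η := by positivity
  obtain ⟨Q, hQ⟩ := exists_polynomial_norm_approx
    (χ := fun x => Real.exp (χ x / 2) * Real.exp (-δ)) (by fun_prop)
    (by simp only [hend]) (fun x => by positivity) hη0
  have hη1 : ∀ x, η ≤ Real.exp (χ x / 2) * (Real.exp (-δ) * (1 - Real.exp (-δ))) := fun x => by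
    have := (abs_le.1 (hχC x)).1
    exact mul_le_mul_of_nonneg_right (Real.exp_le_exp.2 (by linarith)) (by positivity)
  have hup : ∀ x ∈ Set.Ioo (-Real.pi) Real.pi,
      ‖Q.eval (circleMap 0 1 x)‖ ≤ Real.exp (χ x / 2) := fun x hx => by
    have h1 := (abs_lt.1 (hQ x hx)).2
    have h2 := hη1 x
    have h3 : 0 ≤ Real.exp (χ x / 2) * ((1 - Real.exp (-δ)) * (1 - Real.exp (-δ))) := by positivity
    linarith
  have hlow : ∀ x ∈ Set.Ioo (-Real.pi) Real.pi,
      Real.exp (χ x / 2 - 2 * δ) ≤ ‖Q.eval (circleMap 0 1 x)‖ := fun x hx => by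
    have h1 := (abs_lt.1 (hQ x hx)).1
    have h2 := hη1 x
    have h3 : Real.exp (χ x / 2 - 2 * δ) =
        Real.exp (χ x / 2) * (Real.exp (-δ) * Real.exp (-δ)) := by
      rw [← Real.exp_add, ← Real.exp_add]
      ring_nf
    rw [h3]
    linarith
  refine ⟨Q, ?_, ?_, ?_⟩
  · rintro rfl
    have h := hlow 0 ⟨by linarith [Real.pi_pos], Real.pi_pos⟩
    rw [eval_zero, norm_zero] at h
    exact absurd h (not_le.2 (Real.exp_pos _))
  · filter_upwards [ae_mem_Ioo, hχw] with x hx hχx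
    have hpos := hm.trans_le (hw x (Set.Ioo_subset_Icc_self hx)).1
    calc ‖Q.eval (circleMap 0 1 x)‖ ^ 2 ≤ Real.exp (χ x / 2) ^ 2 := by gcongr; exact hup x hx
      _ = Real.exp (χ x) := by rw [← Real.exp_nat_mul]; ring_nf
      _ ≤ Real.exp (Real.log (w x)) := Real.exp_le_exp.2 hχx
      _ = w x := Real.exp_log hpos
  · have hχi : IntegrableOn χ Lam := hχ.continuousOn.integrableOn_compact isCompact_Icc
    have h1 : ∫ x in Lam, (χ x / 2 - 2 * δ) ≤
        ∫ x in Lam, Real.log ‖Q.eval (circleMap 0 1 x)‖ := by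
      refine integral_mono_ae ((hχi.div_const 2).sub (integrable_const _))
        (integrableOn_log_norm_eval Q) ?_
      filter_upwards [ae_mem_Ioo] with x hx
      exact (Real.le_log_iff_exp_le ((Real.exp_pos _).trans_le (hlow x hx))).2 (hlow x hx)
    rw [integral_sub (hχi.div_const 2) (integrable_const _), integral_const_Lam,
      integral_div] at h1
    rw [logMahlerMeasure_eq_integral]
    have hpi := Real.pi_pos
    have h2 : (∫ x in Lam, Real.log (w x)) - 2 * Real.pi * ε ≤
        2 * ∫ x in Lam, Real.log ‖Q.eval (circleMap 0 1 x)‖ := by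
      rw [hδ] at h1
      linarith
    have h3 := mul_le_mul_of_nonneg_left h2 (show 0 ≤ 1 / (2 * Real.pi) by positivity)
    have h4 : 1 / (2 * Real.pi) * (2 * Real.pi * ε) = ε := by field_simp
    linarith

end Bounded

/-! ### Minorization of quotients with zeros and poles -/

section Quotient

variable {h c : ℝ → ℝ} {m M : ℝ} {P : ℂ[X]}

lemma log_mul_div {a b y : ℝ} (ha : 0 < a) (hb : 0 < b) (hy : 0 < y) :
    Real.log (a * (b ^ 2 / y)) = Real.log a - Real.log y + 2 * Real.log b := by
  rw [Real.log_mul ha.ne' (by positivity), Real.log_div (by positivity) hy.ne', Real.log_pow]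
  push_cast
  ring

lemma ae_log_mul_div (hm : 0 < m) (hh : ∀ x ∈ Lam, m ≤ h x ∧ h x ≤ M) (hP : P ≠ 0)
    (hcpos : ∀ᵐ x ∂(volume.restrict Lam), 0 < c x) :
    ∀ᵐ x ∂(volume.restrict Lam), Real.log (h x * (‖P.eval (circleMap 0 1 x)‖ ^ 2 / c x)) =
      Real.log (h x) - Real.log (c x) + 2 * Real.log ‖P.eval (circleMap 0 1 x)‖ := by
  filter_upwards [ae_norm_eval_pos hP, hcpos, ae_restrict_mem measurableSet_Icc] with x h1 h2 h3
  exact log_mul_div (hm.trans_le (hh x h3).1) h1 h2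

lemma integrableOn_log_mul_div (hm : 0 < m) (hh : ∀ x ∈ Lam, m ≤ h x ∧ h x ≤ M)
    (hc : ∀ᵐ x ∂(volume.restrict Lam), ContinuousAt h x) (hP : P ≠ 0)
    (hcpos : ∀ᵐ x ∂(volume.restrict Lam), 0 < c x)
    (hclog : IntegrableOn (fun x => Real.log (c x)) Lam) :
    IntegrableOn (fun x => Real.log (h x * (‖P.eval (circleMap 0 1 x)‖ ^ 2 / c x))) Lam := by
  refine (((integrableOn_log_of_ae_continuousAt hm hh hc).sub hclog).add
    ((integrableOn_log_norm_eval P).const_mul 2)).congr ?_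
  filter_upwards [ae_log_mul_div hm hh hP hcpos] with x hx
  rw [hx]
  rfl

/-- Dominated convergence: where `c > 0`, `log (c + 1/(k+1))` lies between the integrable functions
`log c` and `log (c + 1)`. -/
lemma tendsto_integral_log_add {c : ℝ → ℝ} (hcc : Continuous c) (hc0 : ∀ x, 0 ≤ c x)
    (hcpos : ∀ᵐ x ∂(volume.restrict Lam), 0 < c x)
    (hclog : IntegrableOn (fun x => Real.log (c x)) Lam) :
    Tendsto (fun k : ℕ => ∫ x in Lam, Real.log (c x + 1 / ((k : ℝ) + 1))) atTop
      (𝓝 (∫ x in Lam, Real.log (c x))) := by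
  have hpos : ∀ (k : ℕ) x, 0 < c x + 1 / ((k : ℝ) + 1) := fun k x =>
    add_pos_of_nonneg_of_pos (hc0 x) Nat.one_div_pos_of_nat
  have hi : IntegrableOn (fun x => Real.log (c x + 1)) Lam :=
    ((hcc.add continuous_const).log fun x => (add_pos_of_nonneg_of_pos (hc0 x) one_pos).ne').continuousOn.integrableOn_compact
      isCompact_Icc
  refine tendsto_integral_of_dominated_convergence
    (fun x => |Real.log (c x)| + |Real.log (c x + 1)|)
    (fun k => ((hcc.add continuous_const).log fun x => (hpos k x).ne').aestronglyMeasurable)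
    (hclog.abs.add hi.abs) (fun k => ?_) ?_
  · filter_upwards [hcpos] with x hx
    have h1 : 1 / ((k : ℝ) + 1) ≤ 1 := by
      rw [div_le_one (by positivity)]
      linarith [Nat.cast_nonneg (α := ℝ) k]
    exact abs_log_le_of_mem hx (by linarith [Nat.one_div_pos_of_nat (α := ℝ) (n := k)])
      (by linarith)
  · filter_upwards [hcpos] with x hx
    have h1 : Tendsto (fun k : ℕ => c x + 1 / ((k : ℝ) + 1)) atTop (𝓝 (c x)) := by
      simpa using tendsto_const_nhds.add (tendsto_one_div_add_atTop_nhds_zero_nat (𝕜 := ℝ))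
    exact h1.log hx.ne'

/-- The weight `h / (c + δ)` lies between positive constants, so it has a minorant `|Q|²`; then `|P
* Q|²` minorizes the quotient. The two losses, from `δ` and from `Q`, are `ε / 2` each. -/
lemma polyMinorized_mul_div (hm : 0 < m) (hh : ∀ x ∈ Lam, m ≤ h x ∧ h x ≤ M)
    (hc : ∀ᵐ x ∂(volume.restrict Lam), ContinuousAt h x) (hP : P ≠ 0)
    (hcc : Continuous c) (hc0 : ∀ x, 0 ≤ c x)
    (hcpos : ∀ᵐ x ∂(volume.restrict Lam), 0 < c x)
    (hclog : IntegrableOn (fun x => Real.log (c x)) Lam) :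
    PolyMinorized fun x => h x * (‖P.eval (circleMap 0 1 x)‖ ^ 2 / c x) := by
  intro ε hε
  have hpi := Real.pi_pos
  have hhlog := integrableOn_log_of_ae_continuousAt hm hh hc
  have hmean : ∫ x in Lam, Real.log (h x * (‖P.eval (circleMap 0 1 x)‖ ^ 2 / c x)) =
      (∫ x in Lam, Real.log (h x)) - (∫ x in Lam, Real.log (c x)) +
        2 * ∫ x in Lam, Real.log ‖P.eval (circleMap 0 1 x)‖ := by
    rw [integral_congr_ae (ae_log_mul_div hm hh hP hcpos), ← integral_const_mul,
      ← integral_sub hhlog hclog]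
    exact integral_add (hhlog.sub hclog) ((integrableOn_log_norm_eval P).const_mul 2)
  obtain ⟨k, hk⟩ := ((tendsto_integral_log_add hcc hc0 hcpos hclog).eventually
    (gt_mem_nhds (lt_add_of_pos_right _ (mul_pos hpi hε)))).exists
  set δ := 1 / ((k : ℝ) + 1) with hδ
  have hδ0 : 0 < δ := Nat.one_div_pos_of_nat
  have hcδ : ∀ x, 0 < c x + δ := fun x => add_pos_of_nonneg_of_pos (hc0 x) hδ0
  obtain ⟨K, hK⟩ := (isCompact_Icc (a := -Real.pi) (b := Real.pi)).bddAbove_image hcc.continuousOn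
  have hK' : ∀ x ∈ Lam, c x ≤ K := fun x hx => hK ⟨x, hx, rfl⟩
  have hK0 : 0 ≤ K := (hc0 0).trans (hK' 0 ⟨by linarith, hpi.le⟩)
  have hw : ∀ x ∈ Lam, m / (K + δ) ≤ h x / (c x + δ) ∧ h x / (c x + δ) ≤ M / δ := by
    intro x hx
    have h1 := (hh x hx).1
    have h2 := (hh x hx).2
    have h3 := hK' x hx
    have h4 := hcδ x
    have h5 := hc0 x
    have h6 : 0 ≤ h x := hm.le.trans h1
    constructor
    · gcongr
    · exact div_le_div₀ (h6.trans h2) h2 hδ0 (by linarith)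
  have hwc : ∀ᵐ x ∂(volume.restrict Lam), ContinuousAt (fun x => h x / (c x + δ)) x := by
    filter_upwards [hc] with x hx
    exact hx.div (hcc.continuousAt.add continuousAt_const) (hcδ x).ne'
  obtain ⟨Q, hQ0, hQ, hQint⟩ := polyMinorized_of_ae_continuousAt
    (div_pos hm (by linarith)) hw hwc (ε / 2) (half_pos hε)
  have hi : IntegrableOn (fun x => Real.log (c x + δ)) Lam :=
    ((hcc.add continuous_const).log fun x => (hcδ x).ne').continuousOn.integrableOn_compact
      isCompact_Icc
  have hwint : ∫ x in Lam, Real.log (h x / (c x + δ)) =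
      (∫ x in Lam, Real.log (h x)) - ∫ x in Lam, Real.log (c x + δ) := by
    rw [← integral_sub hhlog hi]
    refine setIntegral_congr_fun measurableSet_Icc fun x hx => ?_
    exact Real.log_div (hm.trans_le (hh x hx).1).ne' (hcδ x).ne'
  refine ⟨P * Q, mul_ne_zero hP hQ0, ?_, ?_⟩
  · filter_upwards [hQ, hcpos, ae_restrict_mem measurableSet_Icc] with x h1 h2 h3
    have h4 : 0 ≤ h x := hm.le.trans (hh x h3).1
    rw [eval_mul, norm_mul, mul_pow]
    calc _ ≤ ‖P.eval (circleMap 0 1 x)‖ ^ 2 * (h x / (c x + δ)) := by gcongr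
      _ ≤ ‖P.eval (circleMap 0 1 x)‖ ^ 2 * (h x / c x) := by
        gcongr
        linarith
      _ = _ := by ring
  · rw [logMahlerMeasure_mul_eq_add_logMahlerMeasure (mul_ne_zero hP hQ0),
      logMahlerMeasure_eq_integral P, hmean]
    rw [hwint] at hQint
    have h1 := mul_le_mul_of_nonneg_left hk.le (show 0 ≤ 1 / (2 * Real.pi) by positivity)
    have h2 : 1 / (2 * Real.pi) * (Real.pi * ε) = ε / 2 := by field_simp
    linarith

end Quotient

/-! ### The two families of multipliers -/

lemma PolyMinorized.congr {g g' : ℝ → ℝ} (hg : PolyMinorized g) (h : ∀ x ∈ Lam, g' x = g x) :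
    PolyMinorized g' := by
  intro ε hε
  obtain ⟨Q, h0, h1, h2⟩ := hg ε hε
  refine ⟨Q, h0, ?_, ?_⟩
  · filter_upwards [h1, ae_restrict_mem measurableSet_Icc] with x hx hxL
    rwa [h x hxL]
  · rwa [setIntegral_congr_fun (s := Lam) measurableSet_Icc fun x hx => congrArg Real.log (h x hx)]

/-- The multiplier theorem for `g = h |P|² / c` with `1 / g = |R|² / (h d)`. -/
theorem mem_classM_of_eq_mul_div {f g h c d : ℝ → ℝ} {m M : ℝ} {P R : ℂ[X]} (hf : f ∈ classF)
    (hm : 0 < m) (hM : 0 < M) (hh : ∀ x ∈ Lam, m ≤ h x ∧ h x ≤ M)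
    (hcont : ∀ᵐ x ∂(volume.restrict Lam), ContinuousAt h x) (hP : P ≠ 0) (hR : R ≠ 0)
    (hcc : Continuous c) (hc0 : ∀ x, 0 ≤ c x) (hcpos : ∀ᵐ x ∂(volume.restrict Lam), 0 < c x)
    (hclog : IntegrableOn (fun x => Real.log (c x)) Lam)
    (hdc : Continuous d) (hd0 : ∀ x, 0 ≤ d x) (hdpos : ∀ᵐ x ∂(volume.restrict Lam), 0 < d x)
    (hdlog : IntegrableOn (fun x => Real.log (d x)) Lam)
    (hg : ∀ x ∈ Lam, g x = h x * (‖P.eval (circleMap 0 1 x)‖ ^ 2 / c x))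
    (hg' : ∀ x ∈ Lam, (g x)⁻¹ = (h x)⁻¹ * (‖R.eval (circleMap 0 1 x)‖ ^ 2 / d x))
    (hfg : IntegrableOn (fun x => f x * g x) Lam) :
    g ∈ classM f ∧ (fun x => f x * g x) ∈ classF := by
  have hpos : ∀ x ∈ Lam, 0 < h x := fun x hx => hm.trans_le (hh x hx).1
  refine mem_classM_of_polyMinorized hf (fun x hx => ?_) ?_ ?_ hfg ?_ ?_
  · rw [hg x hx]
    have := hpos x hx
    have := hc0 x
    positivity
  · filter_upwards [ae_norm_eval_pos hP, hcpos, ae_restrict_mem measurableSet_Icc] with x h1 h2 h3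
    rw [hg x h3]
    have := hpos x h3
    positivity
  · refine (integrableOn_congr_fun (fun x hx => ?_) measurableSet_Icc).2
      (integrableOn_log_mul_div hm hh hcont hP hcpos hclog)
    rw [hg x hx]
  · exact (polyMinorized_mul_div hm hh hcont hP hcc hc0 hcpos hclog).congr hg
  · refine (polyMinorized_mul_div (inv_pos.2 hM) (M := m⁻¹) (fun x hx => ?_) ?_ hR hdc hd0 hdpos
      hdlog).congr hg'
    · exact ⟨inv_anti₀ (hpos x hx) (hh x hx).2, inv_anti₀ hm (hh x hx).1⟩
    · filter_upwards [hcont, ae_restrict_mem measurableSet_Icc] with x hx hxL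
      exact hx.inv₀ (hpos x hxL).ne'

lemma ae_continuousAt_of_mem_classBpm {h : ℝ → ℝ} (hh : h ∈ classBpm) :
    ∀ᵐ x ∂(volume.restrict Lam), ContinuousAt h x :=
  hh.1.ae_continuousAt (by linarith [Real.pi_pos])

/-- For an integer `K > α`, `|t|^α = |t|^{2K} / |t|^{2K-α}` has a squared modulus on top and a
continuous denominator; the reciprocal is already `1 / |t|^α`. -/
theorem mem_classM_mul_abs_rpow {f h t : ℝ → ℝ} {α : ℝ} (hf : f ∈ classF) (hh : h ∈ classBpm)
    (ht : IsTrigPoly t) (ht0 : t ≠ 0) (hα : 0 < α) :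
    (fun x => h x * |t x| ^ α) ∈ classM f ∧ (fun x => f x * (h x * |t x| ^ α)) ∈ classF := by
  have hcont := ae_continuousAt_of_mem_classBpm hh
  obtain ⟨-, m, M, hm, hM, hhb⟩ := hh
  obtain ⟨Q, hQ0, hQ⟩ := exists_polynomial_norm_eq_abs ht ht0
  obtain ⟨K, hK⟩ := exists_nat_gt α
  have hβ : 0 < 2 * K - α := by linarith
  have htc : Continuous fun x => |t x| := by
    simpa only [← hQ] using (continuous_eval_circleMap Q).norm
  have htpos : ∀ᵐ x ∂(volume.restrict Lam), 0 < |t x| := by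
    simpa only [hQ] using ae_norm_eval_pos hQ0
  have hrc : ∀ β : ℝ, 0 < β → Continuous fun x => |t x| ^ β := fun β hβ =>
    htc.rpow_const fun _ => Or.inr hβ.le
  have hrpos : ∀ β : ℝ, ∀ᵐ x ∂(volume.restrict Lam), 0 < |t x| ^ β := fun β => by
    filter_upwards [htpos] with x hx using Real.rpow_pos_of_pos hx β
  have hrlog : ∀ β : ℝ, IntegrableOn (fun x => Real.log (|t x| ^ (β : ℝ))) Lam := fun β => by
    refine ((integrableOn_log_norm_eval Q).const_mul β).congr ?_
    filter_upwards [htpos] with x hx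
    rw [Real.log_rpow hx, hQ]
  refine mem_classM_of_eq_mul_div (P := Q ^ K) (R := 1) (c := fun x => |t x| ^ (2 * K - α))
    (d := fun x => |t x| ^ α) hf hm hM hhb hcont (pow_ne_zero _ hQ0) one_ne_zero
    (hrc _ hβ) (fun x => by positivity) (hrpos _) (hrlog _)
    (hrc _ hα) (fun x => by positivity) (hrpos _) (hrlog _) (fun x _ => ?_) (fun x _ => ?_) ?_
  · rw [eval_pow, norm_pow, hQ]
    congr 1
    -- At zeros of `t` both sides are `0`, by the convention `x / 0 = 0`.
    rcases (abs_nonneg (t x)).eq_or_lt with h0 | h0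
    · rw [← h0, Real.zero_rpow hα.ne', Real.zero_rpow hβ.ne', div_zero]
    · rw [eq_div_iff (Real.rpow_pos_of_pos h0 _).ne', ← Real.rpow_add h0, ← pow_mul,
        ← Real.rpow_natCast]
      congr 1
      push_cast
      ring
  · simp [mul_comm]
  -- Integrability of `fg` is automatic here because `g` is bounded.
  · obtain ⟨B, hB⟩ := (isCompact_Icc (a := -Real.pi) (b := Real.pi)).bddAbove_image
      (hrc α hα).continuousOn
    have hB' : ∀ x ∈ Lam, |t x| ^ α ≤ B := fun x hx => hB ⟨x, hx, rfl⟩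
    have hhm : AEStronglyMeasurable h (volume.restrict Lam) := by
      refine aestronglyMeasurable_of_ae_continuousAt (C := M) (fun x hx => abs_le.2 ⟨?_, ?_⟩) hcont
      · linarith [(hhb x hx).1]
      · exact (hhb x hx).2
    refine hf.1.mul_bdd (c := M * B) (hhm.mul (hrc α hα).aestronglyMeasurable) ?_
    filter_upwards [ae_restrict_mem measurableSet_Icc] with x hx
    have h1 : 0 ≤ h x := hm.le.trans (hhb x hx).1
    have h2 : 0 ≤ |t x| ^ α := by positivity
    rw [Real.norm_of_nonneg (mul_nonneg h1 h2)]
    exact mul_le_mul (hhb x hx).2 (hB' x hx) h2 hM.le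

/-- Since `t₁ = |P|` and `t₂ = |R|`, writing `t₁ / t₂ = t₁² / (t₁ t₂)` and `t₂ / t₁ = t₂² / (t₁ t₂)`
produces squared moduli over a common continuous denominator. -/
theorem mem_classM_mul_div {f h t₁ t₂ : ℝ → ℝ} (hf : f ∈ classF) (hh : h ∈ classBpm)
    (ht₁ : IsTrigPoly t₁) (ht₂ : IsTrigPoly t₂) (hn₁ : ∀ x, 0 ≤ t₁ x) (hn₂ : ∀ x, 0 ≤ t₂ x)
    (h₁ : t₁ ≠ 0) (h₂ : t₂ ≠ 0)
    (hfg : IntegrableOn (fun x => f x * (h x * (t₁ x / t₂ x))) Lam) :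
    (fun x => h x * (t₁ x / t₂ x)) ∈ classM f ∧
      (fun x => f x * (h x * (t₁ x / t₂ x))) ∈ classF := by
  have hcont := ae_continuousAt_of_mem_classBpm hh
  obtain ⟨-, m, M, hm, hM, hhb⟩ := hh
  obtain ⟨P, hP0, hP⟩ := exists_polynomial_norm_eq_abs ht₁ h₁
  obtain ⟨R, hR0, hR⟩ := exists_polynomial_norm_eq_abs ht₂ h₂
  replace hP : ∀ x, ‖P.eval (circleMap 0 1 x)‖ = t₁ x := fun x => by rw [hP, abs_of_nonneg (hn₁ x)]
  replace hR : ∀ x, ‖R.eval (circleMap 0 1 x)‖ = t₂ x := fun x => by rw [hR, abs_of_nonneg (hn₂ x)]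
  have hcc : Continuous fun x => t₁ x * t₂ x := by
    simp only [← hP, ← hR]
    exact (continuous_eval_circleMap P).norm.mul (continuous_eval_circleMap R).norm
  have hc0 : ∀ x, 0 ≤ t₁ x * t₂ x := fun x => mul_nonneg (hn₁ x) (hn₂ x)
  have hcpos : ∀ᵐ x ∂(volume.restrict Lam), 0 < t₁ x * t₂ x := by
    filter_upwards [ae_norm_eval_pos hP0, ae_norm_eval_pos hR0] with x h1 h2
    rw [hP] at h1
    rw [hR] at h2
    exact mul_pos h1 h2
  have hclog : IntegrableOn (fun x => Real.log (t₁ x * t₂ x)) Lam := by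
    simpa only [eval_mul, norm_mul, hP, hR] using integrableOn_log_norm_eval (P * R)
  have hdiv : ∀ a b : ℝ, a / b = a ^ 2 / (a * b) := fun a b => by
    rcases eq_or_ne a 0 with rfl | ha
    · simp
    · rw [sq, mul_div_mul_left _ _ ha]
  refine mem_classM_of_eq_mul_div hf hm hM hhb hcont hP0 hR0 hcc hc0 hcpos hclog hcc hc0 hcpos hclog
    (fun x _ => ?_) (fun x _ => ?_) hfg
  · rw [hP, ← hdiv]
  · rw [hR, mul_comm (t₁ x), ← hdiv, mul_inv, inv_div]

end FinitePrediction
end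

theorem theoremT1 (f : ℝ → ℝ) (hf : f ∈ FinitePrediction.classF)
    (h : ℝ → ℝ) (hh : h ∈ FinitePrediction.classBpm) :
    (∀ (t : ℝ → ℝ) (α : ℝ), FinitePrediction.IsTrigPoly t → t ≠ 0 → 0 < α →
      (fun x => h x * |t x| ^ α) ∈ FinitePrediction.classM f ∧
      (fun x => f x * (h x * |t x| ^ α)) ∈ FinitePrediction.classF) ∧
    (∀ t₁ t₂ : ℝ → ℝ, FinitePrediction.IsTrigPoly t₁ → FinitePrediction.IsTrigPoly t₂ →
      (∀ x, 0 ≤ t₁ x) → (∀ x, 0 ≤ t₂ x) → t₁ ≠ 0 → t₂ ≠ 0 →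
      MeasureTheory.IntegrableOn (fun x => f x * (h x * (t₁ x / t₂ x))) FinitePrediction.Lam →
      (fun x => h x * (t₁ x / t₂ x)) ∈ FinitePrediction.classM f ∧
      (fun x => f x * (h x * (t₁ x / t₂ x))) ∈ FinitePrediction.classF) :=
  ⟨fun _ _ ht ht0 hα => FinitePrediction.mem_classM_mul_abs_rpow hf hh ht ht0 hα,
    fun _ _ ht₁ ht₂ hn₁ hn₂ h₁ h₂ hfg =>
      FinitePrediction.mem_classM_mul_div hf hh ht₁ ht₂ hn₁ hn₂ h₁ h₂ hfg⟩
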